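/- Let $d\ge 1$ and $N\ge 1$ be integers and let $$c(x_1,\dots,x_N)=\sum_{1\le i<j\le N}\frac1{|x_i-x_j|}\in[0,+\infty],\qquad x=(x_1,\dots,x_N)\in(\mathbb R^d)^N,$$ with the convention $1/0=+\infty$. For a Borel probability measure $\rho$ on $\mathbb R^d$ put $$C(\rho)=\inf\Big\{\int_{(\mathbb R^d)^N}c\,dP\ :\ P \text{ a Borel probability measure on }(\mathbb R^d)^N\text{ all of whose } N \text{ marginals equal }\rho\Big\}\in[0,+\infty].$$ For a sub-probability $\rho$ on $\mathbb R^d$, i.e. a nonnegative Borel measure with total mass $\|\rho\|=\rho(\mathbb R^d)\le1$, define the relaxed cost $$\overline C(\rho)=\inf\Big\{\liminf_{n\to\infty}C(\rho_n)\ :\ \rho_n\text{ Borel probability measures},\ \rho_n\overset{*}{\rightharpoonup}\rho\Big\},$$ where $\rho_n\overset{*}{\rightharpoonup}\rho$ means $\int\varphi\,d\rho_n\to\int\varphi\,d\rho$ for every $\varphi\in C_0$, the space of continuous functions $\mathbb R^d\to\mathbb R$ vanishing at infinity. Let $\mathcal A$ be the set of functions $\psi=\varphi+\kappa$ with $\varphi\in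 C_0$, $\kappa\in\mathbb R$, and $\mathcal B$ the set of lower semicontinuous functions $\psi:\mathbb R^d\to\mathbb R$ with $\inf\psi>-\infty$, in both cases subject to $$\frac1N\sum_{i=1}^N\psi(x_i)\le c(x_1,\dots,x_N)\qquad\text{for all }(x_1,\dots,x_N)\in(\mathbb R^d)^N.$$ Put $\psi_\infty=\liminf_{|x|\to\infty}\psi(x)$ (which equals $\kappa$ if $\psi=\varphi+\kappa$ with $\varphi\in C_0$). **Theorem.** For every sub-probability $\rho$ on $\mathbb R^d$, the following equalities hold in $[0,+\infty]$: $$\overline C(\rho)=\sup_{\psi\in\mathcal A}\Big\{\int\psi\,d\rho+(1-\|\rho\|)\,\psi_\infty\Big\}=\sup_{\psi\in\mathcal B}\Big\{\int\psi\,d\rho+(1-\|\rho\|)\,\psi_\infty\Big\}.$$ -/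

import Mathlib

open Filter Topology MeasureTheory
open scoped ENNReal ZeroAtInfty

namespace RelaxedCost

/-- The space `ℝ^d` with its Euclidean norm. -/
abbrev E (d : ℕ) : Type := EuclideanSpace ℝ (Fin d)

/-- The Coulomb cost `c(x₁, …, x_N) = ∑_{i < j} 1 / |x_i - x_j|` with values in `[0, +∞]`;
here `1 / 0 = +∞`, so that `c = +∞` as soon as two of the points coincide. -/
noncomputable def coulomb {d N : ℕ} (x : Fin N → E d) : ℝ≥0∞ :=
  ∑ i : Fin N, ∑ j ∈ Finset.Ioi i, (edist (x i) (x j))⁻¹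

/-- `Π(ρ)`: the probabilities on `(ℝ^d)^N` all of whose `N` marginals are equal to `ρ`. -/
def plans {d : ℕ} (N : ℕ) (ρ : Measure (E d)) : Set (Measure (Fin N → E d)) :=
  {P | IsProbabilityMeasure P ∧ ∀ i : Fin N, P.map (fun x => x i) = ρ}

/-- The multi-marginal transport cost `C(ρ) = inf {∫ c dP : P ∈ Π(ρ)}` (`+∞` is allowed). -/
noncomputable def cost {d : ℕ} (N : ℕ) (ρ : Measure (E d)) : ℝ≥0∞ :=
  ⨅ P ∈ plans N ρ, ∫⁻ x, coulomb x ∂P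

/-- Weak* convergence of a sequence of probabilities to a measure, in duality with `C₀`. -/
def WeakStarTendsto {d : ℕ} (μ : ℕ → ProbabilityMeasure (E d)) (ρ : Measure (E d)) : Prop :=
  ∀ φ : C₀(E d, ℝ),
    Tendsto (fun n => ∫ x, φ x ∂(μ n : Measure (E d))) atTop (𝓝 (∫ x, φ x ∂ρ))

/-- The relaxed cost
`C̄(ρ) = inf {liminf C(ρ_n) : ρ_n probabilities converging weakly* to ρ}`. -/
noncomputable def relaxedCost {d : ℕ} (N : ℕ) (ρ : Measure (E d)) : ℝ≥0∞ :=
  ⨅ (μ : ℕ → ProbabilityMeasure (E d)) (_ : WeakStarTendsto μ ρ),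
    liminf (fun n => cost N (μ n : Measure (E d))) atTop

/-- The pointwise constraint `(1/N) ∑ ψ(x_i) ≤ c(x)` for all `x ∈ (ℝ^d)^N`. -/
def Admissible {d : ℕ} (N : ℕ) (ψ : E d → ℝ) : Prop :=
  ∀ x : Fin N → E d,
    (((1 / (N : ℝ)) * ∑ i : Fin N, ψ (x i) : ℝ) : EReal) ≤ ((coulomb x : ℝ≥0∞) : EReal)

/-- The class `𝒜`: admissible functions in `C₀ ⊕ ℝ`. -/
def classA (d N : ℕ) : Set (E d → ℝ) :=
  {ψ | (∃ (φ : C₀(E d, ℝ)) (κ : ℝ), ∀ x, ψ x = φ x + κ) ∧ Admissible N ψ}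

/-- The class `ℬ`: admissible real functions that are lower semicontinuous and bounded below. -/
def classB (d N : ℕ) : Set (E d → ℝ) :=
  {ψ | (LowerSemicontinuous ψ ∧ BddBelow (Set.range ψ)) ∧ Admissible N ψ}

/-- `ψ_∞ = liminf_{|x| → ∞} ψ(x)`. It is the limit of `ψ` at infinity when `ψ` is in `C₀ ⊕ ℝ`
(`psiInfty_eq`), and functions of class `ℬ` are bounded (`bddAbove_of_mem_classB`), so that this
is a liminf of a bounded function. -/
noncomputable def psiInfty {d : ℕ} (ψ : E d → ℝ) : ℝ :=
  liminf ψ (cocompact (E d))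

/-- The dual objective `∫ ψ dρ + (1 - ‖ρ‖) ψ_∞`. The integrand is integrable for every `ψ` of
class `𝒜` or `ℬ` (`classA_subset_classB`, `integrable_of_mem_classB`). -/
noncomputable def dualValue {d : ℕ} (ρ : Measure (E d)) (ψ : E d → ℝ) : ℝ :=
  (∫ x, ψ x ∂ρ) + (1 - ρ.real Set.univ) * psiInfty ψ

/-! Helper facts: the quantities above are well defined on the two classes. -/

theorem neBot_cocompact {d : ℕ} (hd : 1 ≤ d) : (cocompact (E d)).NeBot := by
  have : Nonempty (Fin d) := ⟨⟨0, hd⟩⟩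
  have : NoncompactSpace (E d) := NormedSpace.noncompactSpace ℝ (E d)
  infer_instance

theorem psiInfty_eq {d : ℕ} (hd : 1 ≤ d) (φ : C₀(E d, ℝ)) (κ : ℝ) :
    psiInfty (fun x => φ x + κ) = κ := by
  have := neBot_cocompact hd
  have h : Tendsto (fun x => φ x + κ) (cocompact (E d)) (𝓝 (0 + κ)) :=
    (zero_at_infty φ).add_const κ
  rw [zero_add] at h
  exact h.liminf_eq

theorem classA_subset_classB (d N : ℕ) : classA d N ⊆ classB d N := by
  rintro ψ ⟨⟨φ, κ, h⟩, hadm⟩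
  obtain rfl : ψ = fun x => φ x + κ := funext h
  refine ⟨⟨?_, ?_⟩, hadm⟩
  · exact ((map_continuous φ).add continuous_const).lowerSemicontinuous
  · refine ⟨-‖φ.toBCF‖ + κ, ?_⟩
    rintro _ ⟨x, rfl⟩
    have h1 := φ.toBCF.norm_coe_le_norm x
    have h2 : -‖φ.toBCF‖ ≤ φ x := (abs_le.1 h1).1
    simpa using h2

theorem bddAbove_of_mem_classB {d N : ℕ} (hd : 1 ≤ d) (hN : 1 ≤ N) {ψ : E d → ℝ}
    (h : ψ ∈ classB d N) : BddAbove (Set.range ψ) := by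
  obtain ⟨⟨-, b, hb⟩, hadm⟩ := h
  obtain ⟨M, rfl⟩ : ∃ M, N = M + 1 := ⟨N - 1, by omega⟩
  set e : E d := EuclideanSpace.single ⟨0, hd⟩ 1 with he
  have hene : e ≠ 0 := by
    intro h0
    have := congrArg (fun v : E d => v ⟨0, hd⟩) h0
    simp [he] at this
  set y : Fin (M + 1) → E d := fun i => ((i : ℕ) : ℝ) • e
  have hinj : Function.Injective y := by
    intro i j hij
    have h1 := smul_left_injective ℝ hene hij
    exact Fin.ext (by exact_mod_cast h1)
  have hfin : coulomb y ≠ ⊤ := by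
    unfold coulomb
    refine ENNReal.sum_ne_top.2 fun i _ => ENNReal.sum_ne_top.2 fun j hj => ?_
    rw [ENNReal.inv_ne_top]
    exact fun h0 => (Finset.mem_Ioi.1 hj).ne (hinj (edist_eq_zero.1 h0))
  refine ⟨(M + 1 : ℝ) * (coulomb y).toReal - M * b, ?_⟩
  rintro _ ⟨x, rfl⟩
  have htr : coulomb (fun i => x + y i) = coulomb y := by
    simp [coulomb]
  have h1 := hadm (fun i => x + y i)
  rw [htr, ← EReal.coe_ennreal_toReal hfin, EReal.coe_le_coe_iff, Fin.sum_univ_succ] at h1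
  · have h2 : ∑ i : Fin M, b ≤ ∑ i : Fin M, ψ (x + y i.succ) :=
      Finset.sum_le_sum fun i _ => hb ⟨_, rfl⟩
    have h3 : x + y 0 = x := by simp [y]
    rw [h3] at h1
    push_cast at h1
    rw [one_div, inv_mul_le_iff₀ (by positivity)] at h1
    simp at h2
    linarith


theorem integrable_of_mem_classB {d N : ℕ} (hd : 1 ≤ d) (hN : 1 ≤ N) {ψ : E d → ℝ}
    (h : ψ ∈ classB d N) (ρ : Measure (E d)) (hρ : ρ Set.univ ≤ 1) : Integrable ψ ρ := by
  have : IsFiniteMeasure ρ := ⟨hρ.trans_lt ENNReal.one_lt_top⟩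
  obtain ⟨a, ha⟩ := bddAbove_of_mem_classB hd hN h
  obtain ⟨b, hb⟩ := h.1.2
  exact Integrable.of_mem_Icc b a h.1.1.measurable.aemeasurable
    (Eventually.of_forall fun x => ⟨hb ⟨x, rfl⟩, ha ⟨x, rfl⟩⟩)

end RelaxedCost

namespace RelaxedCost

/-! ### Weak duality -/

section Weak

variable {d N : ℕ}

/-! Since `classA` is contained in `classB`, it is enough to bound dual values over `classB` by the
relaxed cost, and the relaxed cost by the supremum over `classA`.

Weak duality (`dualValue_le_relaxedCost`): integrating the constraint against a plan gives `∫ ψ dμ ≤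
C(μ)` for a probability `μ`. If `μ n` converges weakly* to `ρ`, the mass `1 - ‖ρ‖` that is lost
escapes to infinity, where `ψ` is at least `ψ_∞ - ε`. Hence `liminf ∫ ψ dμ n` is at least the dual
value.

Strong duality (`relaxedCost_le`): functions in `C₀ ⊕ ℝ` are the continuous functions on the
one-point compactification, and the dual value is integration against `ρ + (1 - ‖ρ‖) δ_∞`. If all
dual values are at most `D`, Hahn–Banach and Riesz–Markov give a probability `P` on compactified
configurations, with that measure as mean marginal and with `∫ f dP ≤ D` for every continuous `f`
below the cost (`exists_compactified_plan`). Taking for `f` continuous truncations of the cost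
bounds the energy of the finite points. To return to `ℝ^d`, coordinates outside a ball of radius `n`
are sent to points at mutual distance at least `n`, which adds at most `N² / n` to the cost
(`coulomb_spread_le`). Symmetrizing makes all marginals equal (`cost_meanMarginal_le`), and these
marginals converge weakly* to `ρ`. -/

theorem measurable_coulomb : Measurable (coulomb : (Fin N → E d) → ℝ≥0∞) := by
  unfold coulomb
  exact Finset.measurable_sum _ fun i _ => Finset.measurable_sum _ fun j _ =>
    ((measurable_pi_apply i).edist (measurable_pi_apply j)).inv

theorem admissible_iff {ψ : E d → ℝ} :
    Admissible N ψ ↔ ∀ x : Fin N → E d, coulomb x ≠ ⊤ →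
      (N : ℝ)⁻¹ * ∑ i, ψ (x i) ≤ (coulomb x).toReal := by
  refine forall_congr' fun x => ?_
  by_cases hx : coulomb x = ⊤
  · simp [hx]
  · rw [← EReal.coe_ennreal_toReal hx, EReal.coe_le_coe_iff, one_div]
    simp [hx]

/-- The constraint is integrated against a plan of finite cost, for which `c` is finite almost
everywhere. Each of the `N` terms contributes `∫ ψ dμ`, so the mean does too. -/
theorem integral_le_cost (hd : 1 ≤ d) (hN : 1 ≤ N) {ψ : E d → ℝ} (hψ : ψ ∈ classB d N)
    (μ : Measure (E d)) :
    ENNReal.ofReal (∫ x, ψ x ∂μ) ≤ cost N μ := by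
  refine le_iInf₂ fun P hP => ?_
  obtain ⟨hprob, hmarg⟩ := hP
  by_cases htop : ∫⁻ x, coulomb x ∂P = ⊤
  · simp [htop]
  have hμ : IsProbabilityMeasure μ := by
    rw [← hmarg ⟨0, hN⟩]
    exact Measure.isProbabilityMeasure_map (measurable_pi_apply _).aemeasurable
  have hint : Integrable ψ μ := integrable_of_mem_classB hd hN hψ μ (by simp)
  have hinti : ∀ i : Fin N, Integrable (fun x : Fin N → E d => ψ (x i)) P := fun i => by
    have := hint
    rw [← hmarg i] at this
    exact this.comp_measurable (measurable_pi_apply i)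
  have heq : ∀ i : Fin N, ∫ x, ψ (x i) ∂P = ∫ x, ψ x ∂μ := fun i => by
    rw [← hmarg i, integral_map (measurable_pi_apply i).aemeasurable
      hψ.1.1.measurable.aestronglyMeasurable]
  have hN0 : (N : ℝ) ≠ 0 := by positivity
  have h1 : ∫ x, ψ x ∂μ = ∫ x, (N : ℝ)⁻¹ * ∑ i, ψ (x i) ∂P := by
    rw [integral_const_mul, integral_finsetSum _ fun i _ => hinti i]
    simp [heq, hN0]
  have hmeas : Measurable (coulomb : (Fin N → E d) → ℝ≥0∞) := measurable_coulomb
  rw [h1]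
  refine ENNReal.ofReal_le_of_le_toReal ?_
  rw [← integral_toReal hmeas.aemeasurable (ae_lt_top hmeas htop)]
  refine integral_mono_ae ((integrable_finsetSum _ fun i _ => hinti i).const_mul _)
    (integrable_toReal_of_lintegral_ne_top hmeas.aemeasurable htop) ?_
  filter_upwards [ae_lt_top hmeas htop] with x hx
  exact admissible_iff.1 hψ.2 x hx.ne

theorem WeakStarTendsto.tendsto_integral {μ : ℕ → ProbabilityMeasure (E d)} {ρ : Measure (E d)}
    (h : WeakStarTendsto μ ρ) {f : C(E d, ℝ)} (hf : HasCompactSupport f) :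
    Tendsto (fun n => ∫ x, f x ∂(μ n : Measure (E d))) atTop (𝓝 (∫ x, f x ∂ρ)) :=
  h ⟨f, hf.is_zero_at_infty⟩

/-- The open-set half of the portmanteau theorem survives loss of mass at infinity: inner regularity
reduces `G` to a compact subset, and a compactly supported Urysohn function is an allowed test
function. -/
theorem WeakStarTendsto.le_liminf_measure_of_isOpen {μ : ℕ → ProbabilityMeasure (E d)}
    {ρ : Measure (E d)} [IsFiniteMeasure ρ] (h : WeakStarTendsto μ ρ) {G : Set (E d)}
    (hG : IsOpen G) : ρ G ≤ liminf (fun n => (μ n : Measure (E d)) G) atTop := by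
  rw [hG.measure_eq_iSup_isCompact]
  refine iSup₂_le fun K hKG => iSup_le fun hK => ?_
  obtain ⟨f, hf1, hf0, hfc, hf⟩ := exists_continuous_one_zero_of_isCompact hK hG.isClosed_compl
    (Set.disjoint_compl_right_iff_subset.2 hKG)
  have hint : ∀ (ν : Measure (E d)) [IsFiniteMeasure ν], Integrable f ν := fun ν _ =>
    f.continuous.integrable_of_hasCompactSupport hfc
  have h1 : ρ K ≤ ENNReal.ofReal (∫ x, f x ∂ρ) := by
    rw [ofReal_integral_eq_lintegral_ofReal (hint ρ) (.of_forall fun x => (hf x).1),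
      ← lintegral_indicator_one hK.measurableSet]
    refine lintegral_mono (Set.indicator_le fun x hx => ?_)
    simp [hf1 hx]
  have h2 : ∀ n, ENNReal.ofReal (∫ x, f x ∂(μ n : Measure (E d))) ≤ (μ n : Measure (E d)) G := by
    intro n
    rw [ofReal_integral_eq_lintegral_ofReal (hint _) (.of_forall fun x => (hf x).1),
      ← lintegral_indicator_one hG.measurableSet]
    refine lintegral_mono fun x => ?_
    by_cases hx : x ∈ G
    · simpa [hx] using (hf x).2
    · simp [hx, hf0 (show x ∈ Gᶜ from hx)]
  calc ρ K ≤ ENNReal.ofReal (∫ x, f x ∂ρ) := h1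
    _ = liminf (fun n => ENNReal.ofReal (∫ x, f x ∂(μ n : Measure (E d)))) atTop :=
        (ENNReal.tendsto_ofReal (h.tendsto_integral hfc)).liminf_eq.symm
    _ ≤ _ := liminf_le_liminf (.of_forall h2)

/-- Lower semicontinuity of the integral of a nonnegative lower semicontinuous function. -/
theorem lintegral_le_liminf_lintegral_of_lowerSemicontinuous {X : Type*} [TopologicalSpace X]
    [MeasurableSpace X] [BorelSpace X] {μ : Measure X} {μs : ℕ → Measure X} {f : X → ℝ}
    (hf : LowerSemicontinuous f) (hf0 : 0 ≤ f)
    (hopen : ∀ G, IsOpen G → μ G ≤ liminf (fun n => μs n G) atTop) :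
    ∫⁻ x, ENNReal.ofReal (f x) ∂μ ≤ liminf (fun n => ∫⁻ x, ENNReal.ofReal (f x) ∂(μs n)) atTop := by
  -- Layer cake: superlevel sets of a lower semicontinuous function are open, so `hopen` applies to
  -- each level and Fatou's lemma in the level finishes.
  simp_rw [lintegral_eq_lintegral_meas_lt _ (Eventually.of_forall hf0) hf.measurable.aemeasurable]
  refine (lintegral_mono fun t => hopen _ (hf.isOpen_preimage t)).trans ?_
  exact lintegral_liminf_le fun n => Antitone.measurable fun s t hst =>
    measure_mono fun ω hω => lt_of_le_of_lt hst hω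

theorem WeakStarTendsto.eventually_lt_integral {μ : ℕ → ProbabilityMeasure (E d)}
    {ρ : Measure (E d)} [IsFiniteMeasure ρ] (h : WeakStarTendsto μ ρ) {f : E d → ℝ}
    (hf : LowerSemicontinuous f) (hf0 : 0 ≤ f)
    (hint : Integrable f ρ) (hint' : ∀ n, Integrable f (μ n : Measure (E d)))
    {b : ℝ} (hb : b < ∫ x, f x ∂ρ) : ∀ᶠ n in atTop, b < ∫ x, f x ∂(μ n : Measure (E d)) := by
  rcases lt_or_ge b 0 with hb0 | hb0
  · exact .of_forall fun n => hb0.trans_le (integral_nonneg hf0)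
  have h1 := lintegral_le_liminf_lintegral_of_lowerSemicontinuous hf hf0
    fun G hG => h.le_liminf_measure_of_isOpen hG
  rw [← ofReal_integral_eq_lintegral_ofReal hint (.of_forall hf0)] at h1
  have h2 := eventually_lt_of_lt_liminf
    (((ENNReal.ofReal_lt_ofReal_iff_of_nonneg hb0).2 hb).trans_le h1)
  filter_upwards [h2] with n hn
  rw [← ofReal_integral_eq_lintegral_ofReal (hint' n) (.of_forall hf0)] at hn
  exact (ENNReal.ofReal_lt_ofReal_iff_of_nonneg hb0).1 hn

/-- Adding a compactly supported bump and a constant makes `ψ` nonnegative, so the previous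
semicontinuity applies. The bump's integral converges, while the constant is integrated against mass
`1` along the sequence and mass `‖ρ‖` in the limit. This mismatch produces the term `(1 - ‖ρ‖) ψ_∞`.
-/
theorem eventually_lt_integral_of_mem_classB (hd : 1 ≤ d) (hN : 1 ≤ N)
    {μ : ℕ → ProbabilityMeasure (E d)} {ρ : Measure (E d)} (hρ : ρ Set.univ ≤ 1)
    (h : WeakStarTendsto μ ρ) {ψ : E d → ℝ} (hψ : ψ ∈ classB d N) {b : ℝ}
    (hb : b < dualValue ρ ψ) : ∀ᶠ n in atTop, b < ∫ x, ψ x ∂(μ n : Measure (E d)) := by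
  have := neBot_cocompact hd
  have hfin : IsFiniteMeasure ρ := ⟨hρ.trans_lt ENNReal.one_lt_top⟩
  have hρ0 : 0 ≤ ρ.real Set.univ := measureReal_nonneg
  obtain ⟨m, hm⟩ := hψ.1.2
  have hm' : ∀ x, m ≤ ψ x := fun x => hm ⟨x, rfl⟩
  -- Three losses of `ε` occur: in `∫ f`, in the bump term and in replacing `ψ_∞` by `ψ_∞ - ε`. The
  -- fourth quarter is slack.
  set ε : ℝ := (dualValue ρ ψ - b) / 4 with hε
  have hε0 : 0 < ε := by rw [hε]; linarith
  have hbdd : IsBoundedUnder (· ≥ ·) (cocompact (E d)) ψ := isBoundedUnder_of ⟨m, hm'⟩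
  have hev : ∀ᶠ x in cocompact (E d), psiInfty ψ - ε < ψ x :=
    eventually_lt_of_lt_liminf (show psiInfty ψ - ε < liminf ψ _ by
      rw [psiInfty]; linarith) hbdd
  obtain ⟨K, hK, hKψ⟩ := mem_cocompact.1 hev
  obtain ⟨θ, hθ1, -, hθc, hθ⟩ := exists_continuous_one_zero_of_isCompact hK isClosed_empty
    (Set.disjoint_empty K)
  -- This height compensates the lower bound `m` of `ψ` on `K`, where the bump equals `1`; off `K`
  -- no compensation is needed.
  set M : ℝ := |m - psiInfty ψ + ε| with hM
  set f : E d → ℝ := fun x => ψ x + (M * θ x - psiInfty ψ + ε) with hfdef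
  have hf : LowerSemicontinuous f :=
    hψ.1.1.add (by fun_prop : Continuous fun x => M * θ x - psiInfty ψ + ε).lowerSemicontinuous
  have hf0 : 0 ≤ f := by
    intro x
    show 0 ≤ ψ x + (M * θ x - psiInfty ψ + ε)
    by_cases hx : x ∈ K
    · have h1 : θ x = 1 := hθ1 hx
      rw [h1]
      have := neg_abs_le (m - psiInfty ψ + ε)
      linarith [hm' x]
    · have h1 : psiInfty ψ - ε < ψ x := hKψ hx
      have h2 : 0 ≤ M * θ x := mul_nonneg (abs_nonneg _) (hθ x).1
      linarith
  have hθi : ∀ (ν : Measure (E d)) [IsFiniteMeasure ν], Integrable θ ν := fun ν _ =>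
    θ.continuous.integrable_of_hasCompactSupport hθc
  have hψi : ∀ (ν : Measure (E d)), ν Set.univ ≤ 1 → Integrable ψ ν :=
    integrable_of_mem_classB hd hN hψ
  have hfi : ∀ (ν : Measure (E d)) [IsFiniteMeasure ν], ν Set.univ ≤ 1 → Integrable f ν :=
    fun ν _ hν => (hψi ν hν).add ((((hθi ν).const_mul M).sub (integrable_const _)).add
      (integrable_const _))
  have hfint : ∀ (ν : Measure (E d)) [IsFiniteMeasure ν], ν Set.univ ≤ 1 →
      ∫ x, f x ∂ν = ∫ x, ψ x ∂ν + (M * ∫ x, θ x ∂ν - ν.real Set.univ * (psiInfty ψ - ε)) := by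
    intro ν _ hν
    have h1 : f = fun x => ψ x + (M * θ x - (psiInfty ψ - ε)) := by
      funext x; simp only [hfdef]; ring
    have h2 : Integrable (fun x => M * θ x - (psiInfty ψ - ε)) ν :=
      ((hθi ν).const_mul M).sub (integrable_const _)
    rw [h1, integral_add (hψi ν hν) h2,
      integral_sub ((hθi ν).const_mul M) (integrable_const _), integral_const_mul, integral_const,
      smul_eq_mul]
  have h1 := h.eventually_lt_integral hf hf0 (hfi ρ hρ) (fun n => hfi _ (by simp))
    (show ∫ x, f x ∂ρ - ε < ∫ x, f x ∂ρ by linarith)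
  have h2 : ∀ᶠ n in atTop, M * ∫ x, θ x ∂(μ n : Measure (E d)) < M * ∫ x, θ x ∂ρ + ε :=
    ((h.tendsto_integral hθc).const_mul M).eventually_lt_const (by linarith)
  filter_upwards [h1, h2] with n hn1 hn2
  rw [hfint ρ hρ, hfint (μ n) (by simp)] at hn1
  simp only [probReal_univ, one_mul] at hn1
  have h3 : dualValue ρ ψ = ∫ x, ψ x ∂ρ + (1 - ρ.real Set.univ) * psiInfty ψ := rfl
  have h4 : 0 ≤ ρ.real Set.univ * ε := mul_nonneg hρ0 hε0.le
  nlinarith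

theorem dualValue_le_relaxedCost (hd : 1 ≤ d) (hN : 1 ≤ N) {ρ : Measure (E d)}
    (hρ : ρ Set.univ ≤ 1) {ψ : E d → ℝ} (hψ : ψ ∈ classB d N) :
    ENNReal.ofReal (dualValue ρ ψ) ≤ relaxedCost N ρ := by
  refine le_iInf₂ fun μ hμ => ?_
  refine le_of_forall_lt fun a ha => ?_
  have ha' : a ≠ ⊤ := ne_top_of_lt ha
  rw [← ENNReal.ofReal_toReal ha'] at ha ⊢
  obtain ⟨b, hab, hb⟩ := exists_between ((ENNReal.ofReal_lt_ofReal_iff_of_nonneg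
    ENNReal.toReal_nonneg).1 ha)
  refine ((ENNReal.ofReal_lt_ofReal_iff_of_nonneg ENNReal.toReal_nonneg).2 hab).trans_le ?_
  refine le_liminf_of_le (by isBoundedDefault) ?_
  filter_upwards [eventually_lt_integral_of_mem_classB hd hN hρ hμ hψ hb] with n hn
  exact (ENNReal.ofReal_le_ofReal hn.le).trans (integral_le_cost hd hN hψ _)

end Weak

/-! ### Separation and representation of functionals -/

/-- A form of the Hahn–Banach theorem: a convex cone in `V × ℝ` that projects onto `V` and lies
above `0` over the origin lies above the graph of a linear functional. -/
theorem exists_linearMap_le {V : Type*} [AddCommGroup V] [Module ℝ V] (S : Set (V × ℝ))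
    (hadd : ∀ x ∈ S, ∀ y ∈ S, x + y ∈ S) (hsmul : ∀ c : ℝ, 0 < c → ∀ x ∈ S, c • x ∈ S)
    (hproj : ∀ v, ∃ r, (v, r) ∈ S) (hzero : ∀ r, ((0 : V), r) ∈ S → 0 ≤ r) :
    ∃ L : V →ₗ[ℝ] ℝ, ∀ v r, (v, r) ∈ S → L v ≤ r := by
  let s : PointedCone ℝ (V × ℝ) :=
    { carrier := {x | x ∈ S ∨ x = 0}
      add_mem' := by
        rintro x y (hx | rfl) (hy | rfl)
        · exact .inl (hadd x hx y hy)
        · simpa using Or.inl hx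
        · simpa using Or.inl hy
        · simp
      zero_mem' := .inr rfl
      smul_mem' := by
        rintro ⟨c, hc⟩ x (hx | rfl)
        · rcases hc.eq_or_lt with rfl | hc'
          · exact .inr (zero_smul ℝ x)
          · exact .inl (hsmul c hc' x hx)
        · exact .inr (smul_zero _) }
  -- The functional to extend is the second coordinate on `{0} × ℝ`. A positive extension `g`
  -- satisfies `g (v, r) = g (v, 0) + r ≥ 0` on the cone, so `-g (·, 0)` is the required functional.
  let f : (V × ℝ) →ₗ.[ℝ] ℝ :=
    { domain := LinearMap.ker (LinearMap.fst ℝ V ℝ)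
      toFun := (LinearMap.snd ℝ V ℝ).comp (Submodule.subtype _) }
  obtain ⟨g, hg, hgs⟩ := riesz_extension s f (by
    rintro ⟨⟨v, r⟩, hv⟩ (hx | hx)
    · obtain rfl : v = 0 := hv
      exact hzero r hx
    · obtain ⟨-, rfl⟩ := Prod.mk_eq_zero.1 hx
      exact le_rfl) (by
    rintro ⟨v, r⟩
    obtain ⟨r', hr'⟩ := hproj v
    refine ⟨⟨(0, r' - r), LinearMap.mem_ker.2 rfl⟩, .inl ?_⟩
    simpa using hr')
  refine ⟨-(g.comp (LinearMap.inl ℝ V ℝ)), fun v r h => ?_⟩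
  have h1 := hgs (v, r) (.inl h)
  have h2 : g (0, r) = r := hg ⟨(0, r), LinearMap.mem_ker.2 rfl⟩
  have h3 : g (v, r) = g (v, 0) + g (0, r) := by rw [← map_add]; simp
  simp only [LinearMap.neg_apply, LinearMap.comp_apply, LinearMap.inl_apply]
  linarith

theorem exists_measure_of_positive {Y : Type*} [TopologicalSpace Y] [T2Space Y] [CompactSpace Y]
    [MeasurableSpace Y] [BorelSpace Y] (L : C(Y, ℝ) →ₗ[ℝ] ℝ) (hL : ∀ f, 0 ≤ f → 0 ≤ L f) :
    ∃ P : Measure Y, IsFiniteMeasure P ∧ ∀ f : C(Y, ℝ), ∫ x, f x ∂P = L f := by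
  let Λ : CompactlySupportedContinuousMap Y ℝ →ₚ[ℝ] ℝ :=
    { toFun := fun g => L g.toContinuousMap
      map_add' := fun g g' => L.map_add g.toContinuousMap g'.toContinuousMap
      map_smul' := fun c g => L.map_smul c g.toContinuousMap
      monotone' := fun g g' hgg' => by
        have h := hL (g'.toContinuousMap - g.toContinuousMap) fun x => sub_nonneg.2 (hgg' x)
        rw [map_sub] at h
        exact sub_nonneg.1 h }
  exact ⟨RealRMK.rieszMeasure Λ, inferInstance, fun f => RealRMK.integral_rieszMeasure Λ
    ⟨f, HasCompactSupport.of_compactSpace f⟩⟩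

/-! ### Duality on the one-point compactification -/

section Strong

variable {d N : ℕ}

/-- Integration of continuous functions on the one-point compactification against `ρ`, completed
by a point mass at infinity to a probability. -/
noncomputable def compactifiedIntegral (ρ : Measure (E d)) [IsFiniteMeasure ρ] :
    C(OnePoint (E d), ℝ) →ₗ[ℝ] ℝ where
  toFun ψ := ∫ x, ψ (x : OnePoint (E d)) ∂ρ + (1 - ρ.real Set.univ) * ψ OnePoint.infty
  map_add' ψ χ := by
    have hint : ∀ ψ : C(OnePoint (E d), ℝ), Integrable (fun x : E d => ψ x) ρ := fun ψ =>
      Integrable.of_bound (ψ.continuous.comp OnePoint.continuous_coe).aestronglyMeasurable ‖ψ‖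
        (.of_forall fun x => ψ.norm_coe_le_norm x)
    simp only [ContinuousMap.add_apply]
    rw [integral_add (hint ψ) (hint χ)]
    ring
  map_smul' c ψ := by
    simp only [ContinuousMap.smul_apply, smul_eq_mul, integral_const_mul, RingHom.id_apply]
    ring

theorem compactifiedIntegral_apply (ρ : Measure (E d)) [IsFiniteMeasure ρ]
    (ψ : C(OnePoint (E d), ℝ)) : compactifiedIntegral ρ ψ =
      ∫ x, ψ (x : OnePoint (E d)) ∂ρ + (1 - ρ.real Set.univ) * ψ OnePoint.infty := rfl

theorem compactifiedIntegral_one (ρ : Measure (E d)) [IsFiniteMeasure ρ] :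
    compactifiedIntegral ρ 1 = 1 := by
  simp [compactifiedIntegral_apply]

theorem tendsto_onePoint (ψ : C(OnePoint (E d), ℝ)) :
    Tendsto (fun x : E d => ψ x) (cocompact (E d)) (𝓝 (ψ OnePoint.infty)) := by
  have h := ((OnePoint.continuous_iff ψ).1 ψ.continuous).1
  rwa [coclosedCompact_eq_cocompact] at h

theorem exists_zeroAtInfty_add_const (ψ : C(OnePoint (E d), ℝ)) :
    ∃ (φ : C₀(E d, ℝ)) (κ : ℝ), ∀ x : E d, ψ x = φ x + κ :=
  ⟨⟨⟨fun x => ψ x - ψ OnePoint.infty, by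
      have := ψ.continuous.comp (OnePoint.continuous_coe (X := E d))
      exact this.sub continuous_const⟩, by
    simpa using (tendsto_onePoint ψ).sub_const (ψ OnePoint.infty)⟩, ψ OnePoint.infty,
    fun x => (sub_add_cancel _ _).symm⟩

theorem dualValue_onePoint (hd : 1 ≤ d) (ρ : Measure (E d)) [IsFiniteMeasure ρ]
    (ψ : C(OnePoint (E d), ℝ)) :
    dualValue ρ (fun x : E d => ψ x) = compactifiedIntegral ρ ψ := by
  have := neBot_cocompact hd
  rw [dualValue, compactifiedIntegral_apply, psiInfty, (tendsto_onePoint ψ).liminf_eq]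

/-- Hahn–Banach duality: a bound on the dual values gives a probability on the compactified
configuration space whose mean marginal is the compactification of `ρ`. -/
theorem exists_compactified_plan (hd : 1 ≤ d) (hN : 1 ≤ N) (ρ : Measure (E d)) [IsFiniteMeasure ρ]
    [MeasurableSpace (Fin N → OnePoint (E d))] [BorelSpace (Fin N → OnePoint (E d))]
    {D : ℝ} (hD : ∀ ψ ∈ classA d N, dualValue ρ ψ ≤ D) :
    ∃ P : Measure (Fin N → OnePoint (E d)), IsProbabilityMeasure P ∧
      (∀ ψ : C(OnePoint (E d), ℝ),
        (N : ℝ)⁻¹ * ∑ i, ∫ z, ψ (z i) ∂P = compactifiedIntegral ρ ψ) ∧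
      ∀ f : C(Fin N → OnePoint (E d), ℝ),
        (∀ x : Fin N → E d, coulomb x ≠ ⊤ → f (fun i => x i) ≤ (coulomb x).toReal) →
        ∫ z, f z ∂P ≤ D := by
  have hN0 : (N : ℝ) ≠ 0 := by positivity
  -- This is an epigraph cone for the superhedging price of `f`: the potential `ψ` is bought at its
  -- integral and `t` units of the cost at price `D` each. Keeping `t` positive permits division by
  -- it in the no-arbitrage check over `f = 0`.
  let S : Set (C(Fin N → OnePoint (E d), ℝ) × ℝ) :=
    {p | ∃ (ψ : C(OnePoint (E d), ℝ)) (t : ℝ), 0 < t ∧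
      (∀ x : Fin N → E d, coulomb x ≠ ⊤ →
        p.1 (fun i => x i) ≤ (N : ℝ)⁻¹ * ∑ i, ψ (x i) + t * (coulomb x).toReal) ∧
      compactifiedIntegral ρ ψ + t * D ≤ p.2}
  obtain ⟨L, hL⟩ := exists_linearMap_le S (by
    rintro ⟨f, r⟩ ⟨ψ, t, ht, h1, h2⟩ ⟨g, s⟩ ⟨χ, u, hu, h3, h4⟩
    refine ⟨ψ + χ, t + u, add_pos ht hu, fun x hx => ?_, ?_⟩
    · have h5 := h1 x hx
      have h6 := h3 x hx
      simp only [Prod.fst_add, ContinuousMap.add_apply, Finset.sum_add_distrib] at *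
      linarith
    · simp only [map_add, Prod.snd_add] at *
      linarith) (by
    rintro c hc ⟨f, r⟩ ⟨ψ, t, ht, h1, h2⟩
    refine ⟨c • ψ, c * t, mul_pos hc ht, fun x hx => ?_, ?_⟩
    · have h5 := mul_le_mul_of_nonneg_left (h1 x hx) hc.le
      simp only [Prod.smul_fst, ContinuousMap.smul_apply, smul_eq_mul, ← Finset.mul_sum] at *
      linarith
    · have h5 := mul_le_mul_of_nonneg_left h2 hc.le
      simp only [map_smul, Prod.smul_snd, smul_eq_mul] at *
      linarith) (by
    intro f
    refine ⟨compactifiedIntegral ρ (‖f‖ • 1) + 1 * D, ‖f‖ • 1, 1, one_pos, fun x hx => ?_, le_rfl⟩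
    have h1 := (le_abs_self _).trans (f.norm_coe_le_norm fun i => (x i : OnePoint (E d)))
    have h2 : (0 : ℝ) ≤ (coulomb x).toReal := ENNReal.toReal_nonneg
    simp [hN0]
    linarith) (by
    -- Superhedging `0` says exactly that `-ψ / t` is admissible, so its dual value is at most `D`,
    -- which gives a nonnegative price.
    rintro r ⟨ψ, t, ht, h1, h2⟩
    have hmem : (fun x : E d => (-(t⁻¹ • ψ) : C(OnePoint (E d), ℝ)) x) ∈ classA d N := by
      refine ⟨exists_zeroAtInfty_add_const _, admissible_iff.2 fun x hx => ?_⟩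
      have h3 := h1 x hx
      simp only [ContinuousMap.zero_apply] at h3
      simp only [ContinuousMap.neg_apply, ContinuousMap.smul_apply, smul_eq_mul,
        Finset.sum_neg_distrib, ← Finset.mul_sum]
      have h4 : (N : ℝ)⁻¹ * -(t⁻¹ * ∑ i, ψ (x i)) = t⁻¹ * -((N : ℝ)⁻¹ * ∑ i, ψ (x i)) := by ring
      rw [h4, inv_mul_le_iff₀ ht]
      linarith
    have h3 := hD _ hmem
    rw [dualValue_onePoint hd, map_neg, map_smul, smul_eq_mul, ← mul_neg, inv_mul_le_iff₀ ht] at h3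
    simp only at h2
    linarith)
  -- Letting `t` tend to `0` removes the cost term. Positivity of `L` follows with `ψ = 0`, and the
  -- mean marginal by applying the bound to both signs.
  have hdiag : ∀ f : C(Fin N → OnePoint (E d), ℝ), ∀ ψ : C(OnePoint (E d), ℝ),
      (∀ x : Fin N → E d, f (fun i => x i) ≤ (N : ℝ)⁻¹ * ∑ i, ψ (x i)) →
      L f ≤ compactifiedIntegral ρ ψ := by
    intro f ψ h
    have h1 : ∀ t : ℝ, 0 < t → L f ≤ compactifiedIntegral ρ ψ + t * D := fun t ht =>
      hL f _ ⟨ψ, t, ht, fun x _ => (h x).trans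
        (le_add_of_nonneg_right (mul_nonneg ht.le ENNReal.toReal_nonneg)), le_rfl⟩
    have h2 : Tendsto (fun t : ℝ => compactifiedIntegral ρ ψ + t * D) (𝓝[>] 0)
        (𝓝 (compactifiedIntegral ρ ψ + 0 * D)) :=
      ((continuous_const.add (continuous_id.mul continuous_const)).tendsto 0).mono_left
        nhdsWithin_le_nhds
    rw [zero_mul, add_zero] at h2
    exact ge_of_tendsto h2 (eventually_mem_nhdsWithin.mono fun t ht => h1 t ht)
  obtain ⟨P, hP, hPL⟩ := exists_measure_of_positive L (by
    intro f hf
    have h1 := hdiag (-f) 0 fun x => by simpa using hf fun i => (x i : OnePoint (E d))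
    simpa using h1)
  have hmean : ∀ ψ : C(OnePoint (E d), ℝ),
      (N : ℝ)⁻¹ * ∑ i, ∫ z, ψ (z i) ∂P = compactifiedIntegral ρ ψ := by
    intro ψ
    let F : C(Fin N → OnePoint (E d), ℝ) :=
      (N : ℝ)⁻¹ • ∑ i, ψ.comp ⟨fun z => z i, continuous_apply i⟩
    have hF : ∀ z, F z = (N : ℝ)⁻¹ * ∑ i, ψ (z i) := fun z => by simp [F]
    have h1 : (N : ℝ)⁻¹ * ∑ i, ∫ z, ψ (z i) ∂P = L F := by
      rw [← hPL F]
      simp only [hF]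
      rw [integral_const_mul, integral_finsetSum]
      intro i _
      exact (ψ.continuous.comp (continuous_apply i)).integrable_of_hasCompactSupport
        (HasCompactSupport.of_compactSpace _)
    rw [h1]
    refine le_antisymm (hdiag F ψ fun x => (hF _).le) ?_
    have h2 := hdiag (-F) (-ψ) fun x => by simp [hF]
    rw [map_neg, map_neg] at h2
    linarith
  refine ⟨P, ⟨?_⟩, hmean, fun f hf => ?_⟩
  · have h1 := hmean 1
    rw [compactifiedIntegral_one] at h1
    have h2 : P.real Set.univ = 1 := by simpa [hN0] using h1
    rw [← ENNReal.ofReal_one, ← h2, ofReal_measureReal]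
  · rw [hPL f]
    refine hL f D ⟨0, 1, one_pos, fun x hx => ?_, by simp⟩
    simpa using hf x hx

end Strong

/-! ### Continuous truncations of the cost, and the return to `ℝ^d` -/

section Truncation

variable {d N : ℕ}

theorem continuous_elim_zero {F : Type*} [NormedAddCommGroup F] {f : E d → F} (hf : Continuous f)
    {r : ℝ} (h0 : ∀ x, r ≤ ‖x‖ → f x = 0) :
    Continuous fun z : OnePoint (E d) => z.elim 0 f := by
  refine (OnePoint.continuous_iff _).2 ⟨?_, hf⟩
  rw [coclosedCompact_eq_cocompact]
  refine tendsto_const_nhds.congr' ?_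
  filter_upwards [(isCompact_closedBall (0 : E d) r).compl_mem_cocompact] with x hx
  exact (h0 x (by simpa using (not_le.1 fun h => hx (by simpa using h)).le)).symm

/-- A continuous cutoff: `1` on the ball of radius `r`, `0` off the ball of radius `r + 1`. -/
noncomputable def cutoff (r : ℝ) (z : OnePoint (E d)) : ℝ :=
  z.elim 0 fun x => max 0 (min 1 (r + 1 - ‖x‖))

/-- A continuous map to `E d` that is the identity on the ball of radius `r`. -/
noncomputable def clip (r : ℝ) (z : OnePoint (E d)) : E d :=
  z.elim 0 fun x => max 0 (min 1 (r + 1 - ‖x‖)) • x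

theorem continuous_cutoff (r : ℝ) : Continuous (cutoff r : OnePoint (E d) → ℝ) := by
  refine continuous_elim_zero (by fun_prop) (r := r + 1) fun x hx => max_eq_left ?_
  exact (min_le_right _ _).trans (by linarith)

theorem continuous_clip (r : ℝ) : Continuous (clip r : OnePoint (E d) → E d) := by
  refine continuous_elim_zero (by fun_prop) (r := r + 1) fun x hx => ?_
  rw [max_eq_left ((min_le_right _ _).trans (by linarith)), zero_smul]

theorem cutoff_nonneg (r : ℝ) (z : OnePoint (E d)) : 0 ≤ cutoff r z := by
  induction z with
  | infty => exact le_rfl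
  | coe x => exact le_max_left _ _

theorem cutoff_le_one (r : ℝ) (z : OnePoint (E d)) : cutoff r z ≤ 1 := by
  induction z with
  | infty => exact zero_le_one
  | coe x => exact max_le zero_le_one (min_le_left _ _)

theorem cutoff_coe_eq_one {r : ℝ} {x : E d} (hx : ‖x‖ ≤ r) :
    cutoff r (x : OnePoint (E d)) = 1 := by
  show max 0 (min 1 (r + 1 - ‖x‖)) = 1
  rw [min_eq_left (by linarith), max_eq_right zero_le_one]

theorem cutoff_coe_eq_zero {r : ℝ} {x : E d} (hx : r + 1 ≤ ‖x‖) :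
    cutoff r (x : OnePoint (E d)) = 0 :=
  max_eq_left ((min_le_right _ _).trans (by linarith))

theorem clip_coe_of_le {r : ℝ} {x : E d} (hx : ‖x‖ ≤ r) : clip r (x : OnePoint (E d)) = x := by
  show max 0 (min 1 (r + 1 - ‖x‖)) • x = x
  rw [min_eq_left (by linarith), max_eq_right zero_le_one, one_smul]

/-- A continuous truncation of the Coulomb interaction of two points of the compactification. -/
noncomputable def truncPair (r : ℝ) (k : ℕ) (a b : OnePoint (E d)) : ℝ :=
  cutoff r a * cutoff r b * (max ‖clip (r + 1) a - clip (r + 1) b‖ (1 / ((k : ℝ) + 1)))⁻¹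

theorem max_inv_pos (t : ℝ) (k : ℕ) : 0 < max t (1 / ((k : ℝ) + 1)) :=
  lt_max_of_lt_right (by positivity)

theorem continuous_truncPair (r : ℝ) (k : ℕ) :
    Continuous fun p : OnePoint (E d) × OnePoint (E d) => truncPair r k p.1 p.2 := by
  have h1 := continuous_cutoff (d := d) r
  have h2 := continuous_clip (d := d) (r + 1)
  refine ((h1.comp continuous_fst).mul (h1.comp continuous_snd)).mul (Continuous.inv₀ ?_
    fun p => (max_inv_pos _ k).ne')
  exact ((h2.comp continuous_fst).sub (h2.comp continuous_snd)).norm.max continuous_const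

theorem truncPair_nonneg (r : ℝ) (k : ℕ) (a b : OnePoint (E d)) : 0 ≤ truncPair r k a b :=
  mul_nonneg (mul_nonneg (cutoff_nonneg r a) (cutoff_nonneg r b)) (inv_nonneg.2 (max_inv_pos _ k).le)

theorem monotone_truncPair (r : ℝ) (a b : OnePoint (E d)) : Monotone fun k => truncPair r k a b := by
  intro k l hkl
  refine mul_le_mul_of_nonneg_left ?_ (mul_nonneg (cutoff_nonneg r a) (cutoff_nonneg r b))
  refine inv_anti₀ (max_inv_pos _ l) (max_le_max le_rfl ?_)
  exact Nat.one_div_le_one_div hkl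

theorem ofReal_truncPair_coe_le (r : ℝ) (k : ℕ) (x y : E d) :
    ENNReal.ofReal (truncPair r k (x : OnePoint (E d)) (y : OnePoint (E d))) ≤ (edist x y)⁻¹ := by
  by_cases hx : r + 1 ≤ ‖x‖
  · simp [truncPair, cutoff_coe_eq_zero hx]
  by_cases hy : r + 1 ≤ ‖y‖
  · simp [truncPair, cutoff_coe_eq_zero hy]
  -- Clipping at radius `r + 1` is the identity wherever both cutoffs are nonzero, so the true
  -- distance appears.
  rw [truncPair, clip_coe_of_le (not_le.1 hx).le, clip_coe_of_le (not_le.1 hy).le, edist_dist,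
    dist_eq_norm]
  refine (ENNReal.ofReal_le_ofReal (q := (max ‖x - y‖ (1 / ((k : ℝ) + 1)))⁻¹) ?_).trans ?_
  · refine mul_le_of_le_one_left (inv_nonneg.2 (max_inv_pos _ k).le) ?_
    exact mul_le_one₀ (cutoff_le_one _ _) (cutoff_nonneg _ _) (cutoff_le_one _ _)
  · rw [ENNReal.ofReal_inv_of_pos (max_inv_pos _ k)]
    exact ENNReal.inv_le_inv.2 (ENNReal.ofReal_le_ofReal (le_max_left _ _))

theorem edist_inv_le_iSup_truncPair {r : ℝ} {x y : E d} (hx : ‖x‖ ≤ r) (hy : ‖y‖ ≤ r) :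
    (edist x y)⁻¹ ≤ ⨆ k, ENNReal.ofReal (truncPair r k (x : OnePoint (E d)) (y : OnePoint (E d))) := by
  have h : ∀ k, truncPair r k (x : OnePoint (E d)) (y : OnePoint (E d)) = (max ‖x - y‖ (1 / ((k : ℝ) + 1)))⁻¹ := fun k => by
    rw [truncPair, cutoff_coe_eq_one hx, cutoff_coe_eq_one hy, clip_coe_of_le (by linarith),
      clip_coe_of_le (by linarith), one_mul, one_mul]
  simp only [h]
  by_cases hxy : x = y
  · subst hxy
    have h1 : (⊤ : ℝ≥0∞) ≤
        ⨆ k : ℕ, ENNReal.ofReal (max ‖x - x‖ (1 / ((k : ℝ) + 1)))⁻¹ := by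
      rw [← ENNReal.iSup_natCast]
      refine iSup_mono fun k => ?_
      rw [sub_self, norm_zero, max_eq_right (by positivity), one_div, inv_inv,
        ← ENNReal.ofReal_natCast]
      exact ENNReal.ofReal_le_ofReal (by linarith)
    exact le_top.trans h1
  · have hpos : 0 < ‖x - y‖ := norm_pos_iff.2 (sub_ne_zero.2 hxy)
    obtain ⟨k, hk⟩ := exists_nat_one_div_lt hpos
    refine le_iSup_of_le k ?_
    rw [max_eq_left hk.le, ENNReal.ofReal_inv_of_pos hpos, edist_dist, dist_eq_norm]

/-- The continuous truncation of the Coulomb cost on the compactified configuration space. -/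
noncomputable def truncCost (r : ℝ) (k : ℕ) : C(Fin N → OnePoint (E d), ℝ) where
  toFun z := ∑ i, ∑ j ∈ Finset.Ioi i, truncPair r k (z i) (z j)
  continuous_toFun := continuous_finsetSum _ fun i _ => continuous_finsetSum _ fun j _ =>
    (continuous_truncPair r k).comp (f := fun z : Fin N → OnePoint (E d) => (z i, z j))
      ((continuous_apply i).prodMk (continuous_apply j))

theorem truncCost_apply (r : ℝ) (k : ℕ) (z : Fin N → OnePoint (E d)) :
    truncCost r k z = ∑ i, ∑ j ∈ Finset.Ioi i, truncPair r k (z i) (z j) := rfl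

theorem ofReal_truncCost (r : ℝ) (k : ℕ) (z : Fin N → OnePoint (E d)) :
    ENNReal.ofReal (truncCost r k z) =
      ∑ i, ∑ j ∈ Finset.Ioi i, ENNReal.ofReal (truncPair r k (z i) (z j)) := by
  rw [truncCost_apply,
    ENNReal.ofReal_sum_of_nonneg fun i _ => Finset.sum_nonneg fun j _ => truncPair_nonneg _ _ _ _]
  exact Finset.sum_congr rfl fun i _ =>
    ENNReal.ofReal_sum_of_nonneg fun j _ => truncPair_nonneg _ _ _ _

theorem truncCost_nonneg (r : ℝ) (k : ℕ) (z : Fin N → OnePoint (E d)) : 0 ≤ truncCost r k z := by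
  rw [truncCost_apply]
  exact Finset.sum_nonneg fun _ _ => Finset.sum_nonneg fun _ _ => truncPair_nonneg _ _ _ _

theorem truncCost_coe_le (r : ℝ) (k : ℕ) (x : Fin N → E d) (hx : coulomb x ≠ ⊤) :
    truncCost r k (fun i => (x i : OnePoint (E d))) ≤ (coulomb x).toReal := by
  refine (ENNReal.ofReal_le_iff_le_toReal hx).1 ?_
  rw [ofReal_truncCost]
  exact Finset.sum_le_sum fun i _ => Finset.sum_le_sum fun j _ => ofReal_truncPair_coe_le _ _ _ _

theorem iSup_ofReal_truncCost (r : ℝ) (z : Fin N → OnePoint (E d)) :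
    ⨆ k, ENNReal.ofReal (truncCost r k z) =
      ∑ i, ∑ j ∈ Finset.Ioi i, ⨆ k, ENNReal.ofReal (truncPair r k (z i) (z j)) := by
  have hmono : ∀ a b : OnePoint (E d), Monotone fun k => ENNReal.ofReal (truncPair r k a b) :=
    fun a b => ENNReal.ofReal_mono.comp (monotone_truncPair r a b)
  simp only [ofReal_truncCost]
  rw [← ENNReal.finsetSum_iSup_of_monotone]
  · exact Finset.sum_congr rfl fun i _ =>
      (ENNReal.finsetSum_iSup_of_monotone fun j => hmono _ _).symm
  · exact fun i k l hkl => Finset.sum_le_sum fun j _ => hmono _ _ hkl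

/-- The bound by `D` is known only for continuous functions; monotone convergence carries it to
their supremum, which may be infinite. -/
theorem lintegral_iSup_truncCost_le [MeasurableSpace (Fin N → OnePoint (E d))]
    [BorelSpace (Fin N → OnePoint (E d))] (P : Measure (Fin N → OnePoint (E d)))
    [IsFiniteMeasure P] {D r : ℝ} (hD : ∀ k, ∫ z, truncCost r k z ∂P ≤ D) :
    ∫⁻ z, ⨆ k, ENNReal.ofReal (truncCost r k z) ∂P ≤ ENNReal.ofReal D := by
  rw [lintegral_iSup (fun k => (truncCost r k).continuous.measurable.ennreal_ofReal)]
  · refine iSup_le fun k => ?_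
    rw [← ofReal_integral_eq_lintegral_ofReal
      ((truncCost r k).continuous.integrable_of_hasCompactSupport
        (HasCompactSupport.of_compactSpace _)) (.of_forall (truncCost_nonneg r k))]
    exact ENNReal.ofReal_le_ofReal (hD k)
  · intro k l hkl z
    dsimp only
    rw [truncCost_apply, truncCost_apply]
    exact ENNReal.ofReal_le_ofReal <| Finset.sum_le_sum fun i _ => Finset.sum_le_sum fun j _ =>
      monotone_truncPair r _ _ hkl

/-- The map from the compactification to `E d` which is the identity on the closed ball of
radius `r` and sends all other points to `y`. -/
noncomputable def retract (r : ℝ) (y : E d) : OnePoint (E d) → E d :=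
  Function.extend (fun x : E d => (x : OnePoint (E d))) (fun x => if ‖x‖ ≤ r then x else y)
    fun _ => y

theorem retract_coe_of_le {r : ℝ} (y : E d) {x : E d} (hx : ‖x‖ ≤ r) :
    retract r y (x : OnePoint (E d)) = x := by
  rw [retract, OnePoint.coe_injective.extend_apply, if_pos hx]

theorem retract_eq_or (r : ℝ) (y : E d) (z : OnePoint (E d)) :
    (∃ x : E d, z = x ∧ ‖x‖ ≤ r) ∨ retract r y z = y := by
  induction z with
  | infty => exact .inr (Function.extend_apply' _ _ _ (by simp))
  | coe x =>
    by_cases hx : ‖x‖ ≤ r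
    · exact .inl ⟨x, rfl, hx⟩
    · right
      rw [retract, OnePoint.coe_injective.extend_apply, if_neg hx]

theorem retract_infty (r : ℝ) (y : E d) : retract r y OnePoint.infty = y :=
  Function.extend_apply' _ _ _ (by simp)

theorem measurable_retract_comp {Ω : Type*} [TopologicalSpace Ω] [MeasurableSpace Ω] [BorelSpace Ω]
    {Z : Ω → OnePoint (E d)} (hZ : Continuous Z) (r : ℝ) (y : E d) :
    Measurable fun ω => retract r y (Z ω) := by
  borelize (OnePoint (E d))
  have h : Measurable (retract r y) :=
    OnePoint.isOpenEmbedding_coe.measurableEmbedding.measurable_extend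
      (Measurable.ite (measurableSet_le measurable_norm measurable_const) measurable_id
        measurable_const) measurable_const
  exact h.comp hZ.measurable

/-- Distinct points escaping to infinity along the direction `e`. -/
noncomputable def escape (e : E d) (n i : ℕ) : E d := (((i : ℝ) + 2) * n) • e

theorem norm_escape {e : E d} (he : ‖e‖ = 1) (n i : ℕ) : ‖escape e n i‖ = ((i : ℝ) + 2) * n := by
  rw [escape, norm_smul, he, mul_one, Real.norm_of_nonneg (by positivity)]

theorem le_dist_escape {e : E d} (he : ‖e‖ = 1) (n : ℕ) {i j : ℕ} (hij : i < j) :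
    (n : ℝ) ≤ ‖escape e n i - escape e n j‖ := by
  rw [escape, escape, ← sub_smul, norm_smul, he, mul_one, norm_sub_rev, Real.norm_eq_abs]
  refine le_trans ?_ (le_abs_self _)
  have h1 : (i : ℝ) + 1 ≤ j := by exact_mod_cast hij
  have h2 : (0 : ℝ) ≤ n := by positivity
  nlinarith

/-- The compactified configuration `z` moved into `E d`: points outside the ball of radius `n`
are sent to distinct far away points. -/
noncomputable def spread (e : E d) (n : ℕ) (z : Fin N → OnePoint (E d)) : Fin N → E d :=
  fun i => retract n (escape e n i) (z i)

theorem measurable_spread [MeasurableSpace (Fin N → OnePoint (E d))]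
    [BorelSpace (Fin N → OnePoint (E d))] (e : E d) (n : ℕ) :
    Measurable (spread e n : (Fin N → OnePoint (E d)) → Fin N → E d) :=
  measurable_pi_iff.2 fun i => measurable_retract_comp (continuous_apply i) _ _

/-- Two points kept in the ball have their full interaction counted by the truncations. If at least
one is moved, the images are at distance at least `n`. -/
theorem edist_spread_inv_le {e : E d} (he : ‖e‖ = 1) (n : ℕ) (z : Fin N → OnePoint (E d))
    {i j : Fin N} (hij : i < j) :
    (edist (spread e n z i) (spread e n z j))⁻¹ ≤
      (⨆ k, ENNReal.ofReal (truncPair n k (z i) (z j))) + (n : ℝ≥0∞)⁻¹ := by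
  have hfar : (n : ℝ) ≤ ‖spread e n z i - spread e n z j‖ →
      (edist (spread e n z i) (spread e n z j))⁻¹ ≤
      (⨆ k, ENNReal.ofReal (truncPair n k (z i) (z j))) + (n : ℝ≥0∞)⁻¹ := by
    intro h
    refine le_add_of_nonneg_of_le zero_le (ENNReal.inv_le_inv.2 ?_)
    rw [edist_dist, dist_eq_norm, ← ENNReal.ofReal_natCast]
    exact ENNReal.ofReal_le_ofReal h
  -- The shift by `2` in `escape` puts moved points at norm at least `2 n`, hence at distance at
  -- least `n` from the ball of radius `n`.
  have hesc : ∀ (x : E d) (l : ℕ), ‖x‖ ≤ n → (n : ℝ) ≤ ‖escape e n l - x‖ := by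
    intro x l hx
    have h1 := norm_sub_norm_le (escape e n l) x
    rw [norm_escape he] at h1
    have h2 : (0 : ℝ) ≤ (l : ℝ) * n := by positivity
    linarith
  rcases retract_eq_or n (escape e n i) (z i) with ⟨x, hx, hxn⟩ | hi <;>
    rcases retract_eq_or n (escape e n j) (z j) with ⟨y, hy, hyn⟩ | hj
  · refine le_add_right ?_
    rw [spread, spread, hx, hy, retract_coe_of_le _ hxn, retract_coe_of_le _ hyn]
    exact edist_inv_le_iSup_truncPair hxn hyn
  · refine hfar ?_
    rw [spread, spread, hx, hj, retract_coe_of_le _ hxn, norm_sub_rev]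
    exact hesc _ _ hxn
  · refine hfar ?_
    rw [spread, spread, hy, hi, retract_coe_of_le _ hyn]
    exact hesc _ _ hyn
  · refine hfar ?_
    rw [spread, spread, hi, hj]
    exact le_dist_escape he n hij

theorem coulomb_spread_le {e : E d} (he : ‖e‖ = 1) (n : ℕ) (z : Fin N → OnePoint (E d)) :
    coulomb (spread e n z) ≤ (⨆ k, ENNReal.ofReal (truncCost n k z)) + N * N * (n : ℝ≥0∞)⁻¹ := by
  rw [iSup_ofReal_truncCost]
  calc coulomb (spread e n z)
      ≤ ∑ i : Fin N, ∑ j ∈ Finset.Ioi i,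
        ((⨆ k, ENNReal.ofReal (truncPair n k (z i) (z j))) + (n : ℝ≥0∞)⁻¹) :=
        Finset.sum_le_sum fun i _ => Finset.sum_le_sum fun j hj =>
          edist_spread_inv_le he n z (Finset.mem_Ioi.1 hj)
    _ ≤ _ := by
        simp only [Finset.sum_add_distrib]
        gcongr
        calc ∑ i : Fin N, ∑ j ∈ Finset.Ioi i, (n : ℝ≥0∞)⁻¹
            ≤ ∑ i : Fin N, ∑ j : Fin N, (n : ℝ≥0∞)⁻¹ :=
              Finset.sum_le_sum fun i _ => Finset.sum_le_sum_of_subset (Finset.subset_univ _)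
          _ = N * N * (n : ℝ≥0∞)⁻¹ := by simp [mul_assoc]

/-- A finite coordinate is eventually left in place, and a coordinate at infinity follows an
escaping sequence along which `φ` tends to `0`. -/
theorem tendsto_apply_spread {e : E d} (he : ‖e‖ = 1) (φ : C₀(E d, ℝ))
    (z : Fin N → OnePoint (E d)) (i : Fin N) :
    Tendsto (fun n => φ (spread e n z i)) atTop (𝓝 ((z i).elim 0 φ)) := by
  generalize hz : z i = a
  induction a with
  | infty =>
    refine (zero_at_infty φ).comp ?_
    rw [← Metric.cobounded_eq_cocompact, ← tendsto_norm_atTop_iff_cobounded]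
    simp only [spread, hz, retract_infty, norm_escape he]
    exact tendsto_natCast_atTop_atTop.const_mul_atTop (by positivity)
  | coe x =>
    refine tendsto_const_nhds.congr' ?_
    filter_upwards [tendsto_natCast_atTop_atTop.eventually_ge_atTop ‖x‖] with n hn
    rw [spread, hz, retract_coe_of_le _ hn]
    rfl

end Truncation

/-! ### Symmetrization and the upper bound -/

section Symmetrization

variable {d N : ℕ}

/-- Summing over ordered pairs removes the order on indices, making invariance under relabelling a
change of summation variable. -/
theorem two_mul_coulomb (x : Fin N → E d) :
    2 * coulomb x = ∑ i, ∑ j, if i = j then 0 else (edist (x i) (x j))⁻¹ := by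
  have h1 : coulomb x = ∑ i, ∑ j, if i < j then (edist (x i) (x j))⁻¹ else 0 := by
    refine Finset.sum_congr rfl fun i _ => ?_
    rw [← Finset.sum_filter]
    exact Finset.sum_congr (by ext; simp) fun _ _ => rfl
  have h2 : coulomb x = ∑ i, ∑ j, if j < i then (edist (x i) (x j))⁻¹ else 0 := by
    rw [h1, Finset.sum_comm]
    simp only [edist_comm]
  rw [two_mul]
  nth_rewrite 1 [h1]
  rw [h2, ← Finset.sum_add_distrib]
  refine Finset.sum_congr rfl fun i _ => ?_
  rw [← Finset.sum_add_distrib]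
  refine Finset.sum_congr rfl fun j _ => ?_
  rcases lt_trichotomy i j with h | h | h
  · simp [h, h.ne, h.not_gt]
  · simp [h]
  · simp [h, h.ne', h.not_gt]

theorem coulomb_comp_equiv (x : Fin N → E d) (σ : Equiv.Perm (Fin N)) :
    coulomb (x ∘ σ) = coulomb x := by
  refine (ENNReal.mul_right_inj two_ne_zero ENNReal.ofNat_ne_top).1 ?_
  rw [two_mul_coulomb, two_mul_coulomb,
    ← Equiv.sum_comp σ fun i => ∑ j, if i = j then 0 else (edist (x i) (x j))⁻¹]
  refine Finset.sum_congr rfl fun i _ => ?_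
  rw [← Equiv.sum_comp σ fun j => if σ i = j then 0 else (edist (x (σ i)) (x j))⁻¹]
  simp

/-- The mean of the marginals of a measure on configurations. -/
noncomputable def meanMarginal (Q : Measure (Fin N → E d)) : Measure (E d) :=
  (N : ℝ≥0∞)⁻¹ • ∑ i, Q.map fun x => x i

theorem isProbabilityMeasure_meanMarginal (hN : 1 ≤ N) (Q : Measure (Fin N → E d))
    [IsProbabilityMeasure Q] : IsProbabilityMeasure (meanMarginal Q) := by
  have h : ∀ i : Fin N, IsProbabilityMeasure (Q.map fun x => x i) := fun i =>
    Measure.isProbabilityMeasure_map (measurable_pi_apply i).aemeasurable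
  constructor
  have hN0 : (N : ℝ≥0∞) ≠ 0 := by exact_mod_cast (by omega : N ≠ 0)
  simp [meanMarginal, ENNReal.inv_mul_cancel hN0 (ENNReal.natCast_ne_top N)]

/-- Averaging over the `N` cyclic shifts suffices: under them each coordinate visits every index
exactly once, so every marginal is the mean one, and the symmetric cost is unchanged. -/
theorem cost_meanMarginal_le (hN : 1 ≤ N) (Q : Measure (Fin N → E d)) [IsProbabilityMeasure Q] :
    cost N (meanMarginal Q) ≤ ∫⁻ x, coulomb x ∂Q := by
  have : NeZero N := ⟨by omega⟩
  have hN0 : (N : ℝ≥0∞) ≠ 0 := by exact_mod_cast (by omega : N ≠ 0)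
  have hN1 : (N : ℝ≥0∞)⁻¹ * N = 1 := ENNReal.inv_mul_cancel hN0 (ENNReal.natCast_ne_top N)
  have hsh : ∀ k : Fin N, Measurable fun (x : Fin N → E d) i => x (i + k) := fun k =>
    measurable_pi_iff.2 fun i => measurable_pi_apply _
  have hprob : ∀ k : Fin N, IsProbabilityMeasure (Q.map fun x i => x (i + k)) := fun k =>
    Measure.isProbabilityMeasure_map (hsh k).aemeasurable
  have hplan : (N : ℝ≥0∞)⁻¹ • ∑ k, Q.map (fun x i => x (i + k)) ∈ plans N (meanMarginal Q) := by
    refine ⟨⟨?_⟩, fun i => ?_⟩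
    · simp [hN1]
    · rw [Measure.map_smul, Measure.map_finset_sum' (measurable_pi_apply i).aemeasurable,
        meanMarginal, ← Equiv.sum_comp (Equiv.addLeft i) fun j => Q.map fun x => x j]
      congr 1
      refine Finset.sum_congr rfl fun k _ => ?_
      rw [Measure.map_map (measurable_pi_apply i) (hsh k)]
      rfl
  refine (iInf₂_le _ hplan).trans (le_of_eq ?_)
  rw [lintegral_smul_measure, lintegral_finsetSum_measure]
  have h : ∀ k : Fin N, ∫⁻ x, coulomb x ∂(Q.map fun x i => x (i + k)) = ∫⁻ x, coulomb x ∂Q := by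
    intro k
    rw [lintegral_map measurable_coulomb (hsh k)]
    exact lintegral_congr fun x => coulomb_comp_equiv x (Equiv.addRight k)
  simp [h, ← mul_assoc, hN1]

theorem integral_meanMarginal (Q : Measure (Fin N → E d)) [IsProbabilityMeasure Q]
    (φ : C₀(E d, ℝ)) : ∫ x, φ x ∂(meanMarginal Q) = (N : ℝ)⁻¹ * ∑ i, ∫ x, φ (x i) ∂Q := by
  have hprob : ∀ i : Fin N, IsProbabilityMeasure (Q.map fun x => x i) := fun i =>
    Measure.isProbabilityMeasure_map (measurable_pi_apply i).aemeasurable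
  have hint : ∀ i : Fin N, Integrable φ (Q.map fun x => x i) := fun i => φ.toBCF.integrable _
  rw [meanMarginal, integral_smul_measure, integral_finsetSum_measure fun i _ => hint i]
  simp only [ENNReal.toReal_inv, ENNReal.toReal_natCast, smul_eq_mul]
  congr 1
  refine Finset.sum_congr rfl fun i _ => ?_
  exact integral_map (measurable_pi_apply i).aemeasurable
    (map_continuous φ).aestronglyMeasurable

/-- The extension by `0` of a function vanishing at infinity. -/
noncomputable def extendZero (φ : C₀(E d, ℝ)) : C(OnePoint (E d), ℝ) :=
  OnePoint.continuousMapMk ⟨φ, map_continuous φ⟩ 0 (by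
    rw [coclosedCompact_eq_cocompact]
    exact zero_at_infty φ)

theorem relaxedCost_le (hd : 1 ≤ d) (hN : 1 ≤ N) {ρ : Measure (E d)} (hρ : ρ Set.univ ≤ 1)
    {D : ℝ} (hD : ∀ ψ ∈ classA d N, dualValue ρ ψ ≤ D) :
    relaxedCost N ρ ≤ ENNReal.ofReal D := by
  have hfin : IsFiniteMeasure ρ := ⟨hρ.trans_lt ENNReal.one_lt_top⟩
  borelize (Fin N → OnePoint (E d))
  obtain ⟨P, hP, hmean, hcost⟩ := exists_compactified_plan hd hN ρ hD
  set e : E d := EuclideanSpace.single ⟨0, hd⟩ 1 with he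
  have he1 : ‖e‖ = 1 := by simp [he]
  have hmeas : ∀ n, Measurable (spread e n : (Fin N → OnePoint (E d)) → Fin N → E d) :=
    measurable_spread e
  let Q : ℕ → Measure (Fin N → E d) := fun n => P.map (spread e n)
  have hQ : ∀ n, IsProbabilityMeasure (Q n) := fun n =>
    Measure.isProbabilityMeasure_map (hmeas n).aemeasurable
  let μ : ℕ → ProbabilityMeasure (E d) := fun n =>
    ⟨meanMarginal (Q n), isProbabilityMeasure_meanMarginal hN (Q n)⟩
  have hμ : WeakStarTendsto μ ρ := by
    intro φ
    have h1 : ∀ n, ∫ x, φ x ∂(μ n : Measure (E d)) =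
        (N : ℝ)⁻¹ * ∑ i, ∫ z, φ (spread e n z i) ∂P := by
      intro n
      refine (integral_meanMarginal (Q n) φ).trans ?_
      congr 1
      refine Finset.sum_congr rfl fun i _ => ?_
      exact integral_map (hmeas n).aemeasurable
        ((map_continuous φ).measurable.comp (measurable_pi_apply i)).aestronglyMeasurable
    -- The extension of `φ` vanishes at infinity, so the point mass there contributes nothing.
    have h2 : ∫ x, φ x ∂ρ = (N : ℝ)⁻¹ * ∑ i, ∫ z, extendZero φ (z i) ∂P := by
      rw [hmean, compactifiedIntegral_apply]
      simp [extendZero, OnePoint.continuousMapMk]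
    simp only [h1, h2]
    refine (tendsto_finsetSum _ fun i _ => ?_).const_mul _
    refine tendsto_integral_of_dominated_convergence (fun _ => ‖φ.toBCF‖) (fun n => ?_)
      (integrable_const _) (fun n => .of_forall fun z => φ.toBCF.norm_coe_le_norm _)
      (.of_forall fun z => tendsto_apply_spread he1 φ z i)
    exact ((map_continuous φ).measurable.comp
      ((measurable_pi_apply i).comp (hmeas n))).aestronglyMeasurable
  have hle : ∀ n, cost N (μ n : Measure (E d)) ≤
      ENNReal.ofReal D + N * N * (n : ℝ≥0∞)⁻¹ := by
    intro n
    refine (cost_meanMarginal_le hN (Q n)).trans ?_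
    rw [lintegral_map measurable_coulomb (hmeas n)]
    refine (lintegral_mono fun z => coulomb_spread_le he1 n z).trans ?_
    rw [lintegral_add_right _ measurable_const, lintegral_const, measure_univ, mul_one]
    gcongr
    exact lintegral_iSup_truncCost_le P fun k => hcost _ fun x hx => truncCost_coe_le _ _ x hx
  have hlim : Tendsto (fun n : ℕ => ENNReal.ofReal D + N * N * (n : ℝ≥0∞)⁻¹) atTop
      (𝓝 (ENNReal.ofReal D + N * N * 0)) :=
    (ENNReal.Tendsto.const_mul ENNReal.tendsto_inv_nat_nhds_zero (.inr
      (ENNReal.mul_ne_top (ENNReal.natCast_ne_top N) (ENNReal.natCast_ne_top N)))).const_add _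
  rw [mul_zero, add_zero] at hlim
  refine (iInf₂_le μ hμ).trans ?_
  rw [← hlim.liminf_eq]
  exact liminf_le_liminf (.of_forall hle)

end Symmetrization

end RelaxedCost

theorem mainTheorem1 (d N : ℕ) (hd : 1 ≤ d) (hN : 1 ≤ N)
    (ρ : MeasureTheory.Measure (RelaxedCost.E d)) (hρ : ρ Set.univ ≤ 1) :
    ((RelaxedCost.relaxedCost N ρ : ENNReal) : EReal)
        = (⨆ ψ ∈ RelaxedCost.classA d N, ((RelaxedCost.dualValue ρ ψ : ℝ) : EReal)) ∧
      (⨆ ψ ∈ RelaxedCost.classA d N, ((RelaxedCost.dualValue ρ ψ : ℝ) : EReal))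
        = (⨆ ψ ∈ RelaxedCost.classB d N, ((RelaxedCost.dualValue ρ ψ : ℝ) : EReal)) := by
  set a : EReal := ⨆ ψ ∈ RelaxedCost.classA d N, ((RelaxedCost.dualValue ρ ψ : ℝ) : EReal) with ha
  set b : EReal := ⨆ ψ ∈ RelaxedCost.classB d N, ((RelaxedCost.dualValue ρ ψ : ℝ) : EReal)
  have hab : a ≤ b := biSup_mono fun ψ hψ => RelaxedCost.classA_subset_classB d N hψ
  have hbr : b ≤ (RelaxedCost.relaxedCost N ρ : ENNReal) := by
    refine iSup₂_le fun ψ hψ => ?_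
    have h := RelaxedCost.dualValue_le_relaxedCost hd hN hρ hψ
    refine le_trans ?_ (EReal.coe_ennreal_le_coe_ennreal_iff.2 h)
    rw [EReal.coe_ennreal_ofReal]
    exact EReal.coe_le_coe_iff.2 (le_max_left _ _)
  have hra : ((RelaxedCost.relaxedCost N ρ : ENNReal) : EReal) ≤ a := by
    have hle : ∀ ψ ∈ RelaxedCost.classA d N, ((RelaxedCost.dualValue ρ ψ : ℝ) : EReal) ≤ a :=
      fun ψ hψ => le_iSup₂_of_le ψ hψ le_rfl
    -- The zero potential makes the supremum nonnegative, which excludes `⊥` and makes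
    -- `ENNReal.ofReal` lossless.
    have hmem : (fun _ => (0 : ℝ)) ∈ RelaxedCost.classA d N :=
      ⟨⟨0, 0, by simp⟩, RelaxedCost.admissible_iff.2 fun x _ => by simp⟩
    have h0 : (0 : EReal) ≤ a := by
      have := RelaxedCost.neBot_cocompact hd
      simpa [RelaxedCost.dualValue, RelaxedCost.psiInfty] using hle _ hmem
    clear_value a
    induction a with
    | bot => simp at h0
    | top => exact le_top
    | coe D =>
      have h := RelaxedCost.relaxedCost_le hd hN hρ fun ψ hψ => EReal.coe_le_coe_iff.1 (hle ψ hψ)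
      refine (EReal.coe_ennreal_le_coe_ennreal_iff.2 h).trans ?_
      rw [EReal.coe_ennreal_ofReal, max_eq_left (EReal.coe_nonneg.1 h0)]
  exact ⟨le_antisymm hra (hab.trans hbr), le_antisymm hab (hbr.trans hra)⟩
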